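/- For integers $k,p\ge 3$ let $D_{k,p}$ be the directed graph formed by a loopless $k$-clique (all arcs between distinct nodes) and a disjoint directed $p$-cycle, joined by a bidirectional bridge $x\leftrightarrow y$, where $x$ is a node of the clique and $y$ a node of the cycle. A centrality measure (an isomorphism-invariant assignment of real scores to the nodes of finite directed graphs) satisfies the density axiom if, for all $k=p\ge 3$, the score of $x$ in $D_{k,p}$ is strictly larger than the score of $y$. For a directed graph with adjacency matrix $A$, the HITS scores are the entries of the limit of the $\ell_1$-normalized row vectors $a_i/\|a_i\|_1$, where $a_0=\mathbf 1$ is the all-ones vector, $h_{i+1}=a_iA^T$ and $a_{i+1}=h_{i+1}A$. **Theorem.** HITS satisfies the density axiom. More precisely, for all $k,p\ge 3$ (not only for $k=p$), with $A$ the adjacency matrix of $D_{k,p}$, the vectors $a_i/\|a_i\|_1$ converge, their limit is a left dominant eigenvector of $A^TA$ (a nonzero row vector $v$ with $vA^TA=\mu v$, where $\mu$ is real and at least the modulus of every eigenvalue of $A^TA$), and the HITS score of $x$ is strictly larger than the HITS score of $y$. -/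

import Mathlib

open Filter Topology Matrix

/-- The adjacency matrix of a finite directed graph: the entry `(x, y)` is `1` if there is an arc
`x → y`, and `0` otherwise. -/
noncomputable def Digraph.adjacencyMatrix {V : Type} (G : Digraph V) : Matrix V V ℝ :=
  open Classical in Matrix.of fun x y => if G.Adj x y then 1 else 0

/-- A centrality measure assigns a real score to every node of every finite directed graph, in a
way that depends only on the structure of the graph, not on the labelling of its nodes. -/
structure CentralityMeasure where
  /-- the score of a node -/
  score : ∀ {V : Type} [Fintype V], Digraph V → V → ℝ
  /-- the score is invariant under isomorphism of directed graphs -/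
  score_iso : ∀ {V W : Type} [Fintype V] [Fintype W] (G : Digraph V) (H : Digraph W)
    (e : G.Adj ≃r H.Adj) (v : V), score H (e v) = score G v

/-- The graph `D_{k,p}`: a `k`-clique (all arcs between distinct nodes, no loops) on `Fin k` and a
directed `p`-cycle `j → j + 1 (mod p)` on `Fin p`, connected by the bidirectional bridge `x ↔ y`
between the clique node `x` and the cycle node `y`. -/
def cliqueCycleBridge (k p : ℕ) (x : Fin k) (y : Fin p) : Digraph (Fin k ⊕ Fin p) where
  Adj u v :=
    match u, v with
    | .inl i, .inl j => i ≠ j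
    | .inr i, .inr j => (j : ℕ) = ((i : ℕ) + 1) % p
    | .inl i, .inr j => i = x ∧ j = y
    | .inr i, .inl j => i = y ∧ j = x

/-- The density axiom: in `D_{k,p}` with `k = p ≥ 3`, the clique endpoint of the bridge has
strictly larger centrality than its cycle endpoint. -/
def CentralityMeasure.SatisfiesDensityAxiom (C : CentralityMeasure) : Prop :=
  ∀ (k p : ℕ) (x : Fin k) (y : Fin p), 3 ≤ k → 3 ≤ p → k = p →
    C.score (cliqueCycleBridge k p x y) (.inr y) < C.score (cliqueCycleBridge k p x y) (.inl x)

/-- The authority vectors of the HITS iteration, as row vectors: `a₀ = 1`, and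
`hᵢ₊₁ = aᵢ Aᵀ`, `aᵢ₊₁ = hᵢ₊₁ A`. -/
noncomputable def hitsAuthority {V : Type} [Fintype V] (G : Digraph V) : ℕ → V → ℝ
  | 0 => fun _ => 1
  | i + 1 => (hitsAuthority G i ᵥ* G.adjacencyMatrixᵀ) ᵥ* G.adjacencyMatrix

/-- The authority vectors, rescaled to unit `ℓ₁` norm. -/
noncomputable def hitsNormalized {V : Type} [Fintype V] (G : Digraph V) (i : ℕ) (v : V) : ℝ :=
  hitsAuthority G i v / ∑ w, |hitsAuthority G i w|

/-- The HITS score of a node: the limit of its `ℓ₁`-normalized authority score under the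
iteration started from the all-ones vector. -/
noncomputable def hitsScore {V : Type} [Fintype V] (G : Digraph V) (v : V) : ℝ :=
  limUnder atTop fun i => hitsNormalized G i v

theorem hitsAuthority_iso {V W : Type} [Fintype V] [Fintype W] (G : Digraph V) (H : Digraph W)
    (e : G.Adj ≃r H.Adj) (i : ℕ) (v : V) : hitsAuthority H i (e v) = hitsAuthority G i v := by
  have hA : ∀ a b, H.adjacencyMatrix (e a) (e b) = G.adjacencyMatrix a b := fun a b => by
    simp only [Digraph.adjacencyMatrix, Matrix.of_apply]
    classical exact if_congr e.map_rel_iff rfl rfl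
  induction i generalizing v with
  | zero => rfl
  | succ i ih =>
    simp only [hitsAuthority, Matrix.vecMul, dotProduct, Matrix.transpose_apply]
    rw [← e.toEquiv.sum_comp]
    refine Finset.sum_congr rfl fun a _ => ?_
    rw [← e.toEquiv.sum_comp]
    simp only [RelIso.coe_fn_toEquiv, hA, ih]

theorem hitsScore_iso {V W : Type} [Fintype V] [Fintype W] (G : Digraph V) (H : Digraph W)
    (e : G.Adj ≃r H.Adj) (v : V) : hitsScore H (e v) = hitsScore G v := by
  have h : ∀ i, hitsNormalized H i (e v) = hitsNormalized G i v := fun i => by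
    unfold hitsNormalized
    rw [← e.toEquiv.sum_comp]
    simp only [RelIso.coe_fn_toEquiv, hitsAuthority_iso G H e]
  simp only [hitsScore, h]

/-- HITS as a centrality measure. -/
noncomputable def HITS : CentralityMeasure where
  score := hitsScore
  score_iso := hitsScore_iso

/-- `v` is a left dominant eigenvector of the real square matrix `M`: a nonzero row vector with
`v M = μ v`, where the real number `μ` is at least the modulus of every complex eigenvalue
of `M`. -/
def IsLeftDominantEigenvector {V : Type} [Fintype V] (M : Matrix V V ℝ) (v : V → ℝ) : Prop :=
  v ≠ 0 ∧ ∃ μ : ℝ, v ᵥ* M = μ • v ∧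
    ∀ (ν : ℂ) (w : V → ℂ), w ≠ 0 → w ᵥ* M.map (fun r : ℝ => (r : ℂ)) = ν • w → ‖ν‖ ≤ μ

/-!
The authority vectors are `aₙ = 1 (AᵀA)ⁿ`, so HITS is power iteration for the symmetric positive
semidefinite matrix `M = AᵀA`. In an orthonormal eigenbasis, `aₙ / μⁿ` (with `μ` the largest
eigenvalue) converges to the orthogonal projection `P` of the all-ones vector to the top eigenspace.
As `M` has nonnegative entries, the all-ones vector dominates a multiple of `|v|` for a top
eigenvector `v`, and this persists under iteration, so `P ≠ 0`; hence the `ℓ₁`-normalized vectors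
converge to `P / ‖P‖₁`, a nonnegative top eigenvector. Neither irreducibility nor simplicity of `μ`
is needed (`Matrix.PosSemidef.exists_tendsto_pow_mulVec_one`, `exists_tendsto_hitsNormalized`).

For `D_{k,p}` the diagonal entry of `M` at `x` is `k`, so `μ ≥ k`. Let `S` be the total score of the
clique without `x`. The eigenvector equations at `x` and `y` are
`(μ - k) v_x = (k - 2) S + v_{y+1}` and `(μ - 2) v_y = S`. The other equations show that `S = 0`
forces `v = 0`, so `S > 0`, and then `0 ≤ μ - k < μ - 2` and `k - 2 ≥ 1` give `v_y < v_x`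
(`cliqueCycleBridge_eigenvector_lt`).
-/

/-! ### Power iteration for nonnegative positive semidefinite matrices -/

section PowerIteration

variable {V : Type} [Fintype V]

/-- A real positive semidefinite matrix has a complete orthonormal system `u` of eigenvectors.
Completeness is recorded as the resolution of the identity `∑ j, u j a * u j b = δ_{ab}`. -/
theorem Matrix.PosSemidef.exists_eigensystem [DecidableEq V] {M : Matrix V V ℝ}
    (hM : M.PosSemidef) :
    ∃ (l : V → ℝ) (u : V → V → ℝ), (∀ j, 0 ≤ l j) ∧ (∀ j, M *ᵥ u j = l j • u j) ∧
      (∀ j, u j ≠ 0) ∧ ∀ a b, ∑ j, u j a * u j b = if a = b then 1 else 0 := by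
  refine ⟨hM.1.eigenvalues, fun j => hM.1.eigenvectorBasis j, hM.eigenvalues_nonneg,
    hM.1.mulVec_eigenvectorBasis, fun j h => ?_, fun a b => ?_⟩
  · refine hM.1.eigenvectorBasis.toBasis.ne_zero j ?_
    rw [OrthonormalBasis.coe_toBasis]
    ext v
    exact congrFun h v
  · have h := congrFun (congrFun
      (Matrix.mem_unitaryGroup_iff.mp hM.1.eigenvectorUnitary.2) a) b
    simpa [Matrix.mul_apply, Matrix.star_apply, Matrix.one_apply] using h

theorem sum_mul_eigensystem [DecidableEq V] {R : Type} [CommRing R] [Algebra ℝ R]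
    {u : V → V → ℝ} (hu : ∀ a b, ∑ j, u j a * u j b = if a = b then 1 else 0)
    (w : V → R) (v : V) :
    ∑ j, (∑ a, w a * algebraMap ℝ R (u j a)) * algebraMap ℝ R (u j v) = w v := by
  simp_rw [Finset.sum_mul]
  rw [Finset.sum_comm]
  have h : ∀ a, ∑ j, w a * algebraMap ℝ R (u j a) * algebraMap ℝ R (u j v) =
      w a * algebraMap ℝ R (if a = v then 1 else 0) := fun a => by
    rw [← hu a v, map_sum, Finset.mul_sum]
    simp only [map_mul, mul_assoc]
  simp [h, apply_ite (algebraMap ℝ R)]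

/-- The iterates of a symmetric matrix on a vector, in an eigensystem. -/
theorem pow_mulVec_eigensystem [DecidableEq V] {M : Matrix V V ℝ} {l : V → ℝ} {u : V → V → ℝ}
    (hl : ∀ j, M *ᵥ u j = l j • u j)
    (hu : ∀ a b, ∑ j, u j a * u j b = if a = b then 1 else 0) (w : V → ℝ) (n : ℕ) :
    (M ^ n) *ᵥ w = ∑ j, (l j ^ n * ∑ a, w a * u j a) • u j := by
  induction n with
  | zero =>
    ext v
    simpa using (sum_mul_eigensystem hu w v).symm
  | succ n ih =>
    rw [pow_succ', ← Matrix.mulVec_mulVec, ih, Matrix.mulVec_sum]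
    refine Finset.sum_congr rfl fun j _ => ?_
    rw [Matrix.mulVec_smul, hl, smul_smul]
    congr 1
    ring

/-- The diagonal entries of a symmetric matrix are at most its largest eigenvalue. -/
theorem diag_le_of_eigensystem [DecidableEq V] {M : Matrix V V ℝ} {l : V → ℝ} {u : V → V → ℝ}
    (hl : ∀ j, M *ᵥ u j = l j • u j)
    (hu : ∀ a b, ∑ j, u j a * u j b = if a = b then 1 else 0) {μ : ℝ} (hμ : ∀ j, l j ≤ μ)
    (i : V) : M i i ≤ μ := by
  have h := congrFun (pow_mulVec_eigensystem hl hu (Pi.single i 1) 1) i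
  have hi := hu i i
  simp only [pow_one, Matrix.mulVec_single_one, Matrix.col_apply, Finset.sum_apply,
    Pi.smul_apply, smul_eq_mul, Pi.single_apply, ite_mul, one_mul, zero_mul, Finset.sum_ite_eq',
    Finset.mem_univ, if_true] at h hi
  rw [h, ← mul_one μ, ← hi, Finset.mul_sum]
  refine Finset.sum_le_sum fun j _ => ?_
  rw [mul_assoc]
  exact mul_le_mul_of_nonneg_right (hμ j) (mul_self_nonneg _)

/-- Every complex eigenvalue of a real symmetric matrix occurs in an eigensystem. -/
theorem exists_eq_of_complex_eigenvector [DecidableEq V] {M : Matrix V V ℝ} {l : V → ℝ}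
    {u : V → V → ℝ} (hl : ∀ j, M *ᵥ u j = l j • u j)
    (hu : ∀ a b, ∑ j, u j a * u j b = if a = b then 1 else 0) {ν : ℂ} {w : V → ℂ} (hw : w ≠ 0)
    (hν : w ᵥ* M.map (fun r : ℝ => (r : ℂ)) = ν • w) : ∃ j, ν = l j := by
  obtain ⟨j, hj⟩ : ∃ j, ∑ a, w a * (u j a : ℂ) ≠ 0 := by
    by_contra! h
    refine hw (funext fun v => ?_)
    have := sum_mul_eigensystem hu w v
    simp only [Complex.coe_algebraMap, h] at this
    simpa using this.symm
  refine ⟨j, mul_right_cancel₀ hj ?_⟩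
  have h1 : (M.map (fun r : ℝ => (r : ℂ))) *ᵥ (fun a => (u j a : ℂ)) =
      (l j : ℂ) • fun a => (u j a : ℂ) := by
    ext a
    have := congrFun (hl j) a
    simp only [Matrix.mulVec, dotProduct, Pi.smul_apply, smul_eq_mul, Matrix.map_apply] at this ⊢
    exact_mod_cast this
  have h2 := Matrix.dotProduct_mulVec w (M.map (fun r : ℝ => (r : ℂ))) (fun a => (u j a : ℂ))
  rw [h1, hν, smul_dotProduct, dotProduct_smul] at h2
  simpa [dotProduct] using h2.symm

/-- The iterates of a nonnegative matrix on the all-ones vector dominate, up to a constant, those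
on the modulus of any eigenvector. -/
theorem abs_eigenvector_le_pow_mulVec_one [DecidableEq V] {M : Matrix V V ℝ}
    (hM : ∀ a b, 0 ≤ M a b) {μ : ℝ} (hμ : 0 ≤ μ) {v : V → ℝ} (hv : M *ᵥ v = μ • v)
    (n : ℕ) (a : V) :
    μ ^ n * |v a| ≤ (∑ b, |v b|) * ((M ^ n) *ᵥ (fun _ => 1)) a := by
  induction n generalizing a with
  | zero =>
    simpa using Finset.single_le_sum (f := fun b => |v b|) (fun b _ => abs_nonneg _)
      (Finset.mem_univ a)
  | succ n ih =>
    have hva : μ * |v a| ≤ ∑ b, M a b * |v b| := by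
      have := congrFun hv a
      simp only [Matrix.mulVec, dotProduct, Pi.smul_apply, smul_eq_mul] at this
      rw [← abs_of_nonneg hμ, ← abs_mul, ← this]
      refine (Finset.abs_sum_le_sum_abs _ _).trans_eq (Finset.sum_congr rfl fun b _ => ?_)
      rw [abs_mul, abs_of_nonneg (hM a b)]
    calc μ ^ (n + 1) * |v a| = μ ^ n * (μ * |v a|) := by ring
      _ ≤ μ ^ n * ∑ b, M a b * |v b| := mul_le_mul_of_nonneg_left hva (pow_nonneg hμ n)
      _ = ∑ b, M a b * (μ ^ n * |v b|) := by
        rw [Finset.mul_sum]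
        exact Finset.sum_congr rfl fun b _ => by ring
      _ ≤ ∑ b, M a b * ((∑ c, |v c|) * ((M ^ n) *ᵥ (fun _ => 1)) b) :=
        Finset.sum_le_sum fun b _ => mul_le_mul_of_nonneg_left (ih b) (hM a b)
      _ = (∑ b, |v b|) * ((M ^ (n + 1)) *ᵥ (fun _ => 1)) a := by
        rw [pow_succ', ← Matrix.mulVec_mulVec, Matrix.mulVec, dotProduct, Finset.mul_sum]
        exact Finset.sum_congr rfl fun b _ => by ring

/-- Power iteration from the all-ones vector. The limit `P` is the orthogonal projection of the
all-ones vector to the top eigenspace; it is nonzero because the modulus of a top eigenvector is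
dominated by the iterates. -/
theorem Matrix.PosSemidef.exists_tendsto_pow_mulVec_one [DecidableEq V] {M : Matrix V V ℝ}
    (hM : M.PosSemidef) (hM0 : ∀ a b, 0 ≤ M a b) {i : V} (hi : 0 < M i i) :
    ∃ (μ : ℝ) (P : V → ℝ), M i i ≤ μ ∧ (∀ v, 0 ≤ P v) ∧ P ≠ 0 ∧ M *ᵥ P = μ • P ∧
      (∀ (ν : ℂ) (w : V → ℂ), w ≠ 0 → w ᵥ* M.map (fun r : ℝ => (r : ℂ)) = ν • w → ‖ν‖ ≤ μ) ∧
      ∀ v, Tendsto (fun n => ((M ^ n) *ᵥ (fun _ => 1)) v / μ ^ n) atTop (𝓝 (P v)) := by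
  obtain ⟨l, u, hl0, hl, hne, hu⟩ := hM.exists_eigensystem
  have : Nonempty V := ⟨i⟩
  obtain ⟨t, ht⟩ := Finite.exists_max l
  have hiμ := diag_le_of_eigensystem hl hu ht i
  have hμ : 0 < l t := hi.trans_le hiμ
  set P : V → ℝ := ∑ j, ((if l j = l t then 1 else 0) * ∑ a, 1 * u j a) • u j with hP
  have hlim : ∀ v, Tendsto (fun n => ((M ^ n) *ᵥ (fun _ => 1)) v / l t ^ n) atTop
      (𝓝 (P v)) := fun v => by
    simp only [pow_mulVec_eigensystem hl hu, hP, Finset.sum_apply, Pi.smul_apply, smul_eq_mul,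
      Finset.sum_div]
    refine tendsto_finsetSum _ fun j _ => ?_
    have hj : Tendsto (fun n => (l j / l t) ^ n) atTop (𝓝 (if l j = l t then 1 else 0)) := by
      split_ifs with h
      · simp [h, hμ.ne']
      · exact tendsto_pow_atTop_nhds_zero_of_lt_one (div_nonneg (hl0 j) hμ.le)
          ((div_lt_one hμ).2 (lt_of_le_of_ne (ht j) h))
    refine ((hj.mul_const (∑ a, 1 * u j a)).mul_const (u j v)).congr fun n => ?_
    rw [div_pow]
    ring
  refine ⟨l t, P, hiμ, fun v => ?_, fun h0 => ?_, ?_, fun ν w hw hν => ?_, hlim⟩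
  · refine ge_of_tendsto' (hlim v) fun n => div_nonneg ?_ (pow_nonneg hμ.le n)
    have hn : ∀ (n : ℕ) a, 0 ≤ ((M ^ n) *ᵥ (fun _ => 1)) a := fun n => by
      induction n with
      | zero => simp
      | succ n ih =>
        intro a
        rw [pow_succ', ← Matrix.mulVec_mulVec]
        exact Finset.sum_nonneg fun b _ => mul_nonneg (hM0 a b) (ih b)
    exact hn n v
  · refine hne t (funext fun a => abs_nonpos_iff.1 ?_)
    have h := ge_of_tendsto' ((hlim a).const_mul (∑ b, |u t b|)) (b := |u t a|) fun n => by
      rw [← mul_div_assoc, le_div_iff₀ (pow_pos hμ n), mul_comm]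
      exact abs_eigenvector_le_pow_mulVec_one hM0 hμ.le (hl t) n a
    simpa [h0] using h
  · rw [hP, Matrix.mulVec_sum, Finset.smul_sum]
    refine Finset.sum_congr rfl fun j _ => ?_
    rw [Matrix.mulVec_smul, hl, smul_smul, smul_smul]
    congr 1
    split_ifs with h
    · rw [h, mul_comm]
    · simp
  · obtain ⟨j, rfl⟩ := exists_eq_of_complex_eigenvector hl hu hw hν
    rw [Complex.norm_real, Real.norm_of_nonneg (hl0 j)]
    exact ht j

end PowerIteration

/-! ### Convergence of HITS on a finite directed graph -/

theorem Digraph.adjacencyMatrix_nonneg {V : Type} (G : Digraph V) (a b : V) :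
    0 ≤ G.adjacencyMatrix a b := by
  simp only [Digraph.adjacencyMatrix, Matrix.of_apply]
  split_ifs <;> norm_num

theorem hitsAuthority_eq_pow_mulVec {V : Type} [Fintype V] [DecidableEq V] (G : Digraph V)
    (n : ℕ) :
    hitsAuthority G n = ((G.adjacencyMatrixᵀ * G.adjacencyMatrix) ^ n) *ᵥ (fun _ => 1) := by
  induction n with
  | zero => simp [hitsAuthority]
  | succ n ih =>
    rw [hitsAuthority, ih, pow_succ', Matrix.vecMul_transpose, ← Matrix.mulVec_transpose,
      Matrix.mulVec_mulVec, Matrix.mulVec_mulVec, Matrix.mul_assoc]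

/-- The normalized authority vectors of a graph with an arc converge to a nonnegative left dominant
eigenvector of `AᵀA`, whatever the multiplicity of the dominant eigenvalue. -/
theorem exists_tendsto_hitsNormalized {V : Type} [Fintype V] (G : Digraph V) {i : V}
    (hi : 0 < (G.adjacencyMatrixᵀ * G.adjacencyMatrix) i i) :
    Tendsto (hitsNormalized G) atTop (𝓝 (hitsScore G)) ∧
      IsLeftDominantEigenvector (G.adjacencyMatrixᵀ * G.adjacencyMatrix) (hitsScore G) ∧
      (∀ v, 0 ≤ hitsScore G v) ∧
      ∃ μ : ℝ, (G.adjacencyMatrixᵀ * G.adjacencyMatrix) i i ≤ μ ∧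
        G.adjacencyMatrixᵀ *ᵥ (G.adjacencyMatrix *ᵥ hitsScore G) = μ • hitsScore G := by
  classical
  set M := G.adjacencyMatrixᵀ * G.adjacencyMatrix with hM
  have hpsd : M.PosSemidef := by
    simpa [hM] using Matrix.posSemidef_conjTranspose_mul_self G.adjacencyMatrix
  have hM0 : ∀ a b, 0 ≤ M a b := fun a b => Finset.sum_nonneg fun c _ =>
    mul_nonneg (G.adjacencyMatrix_nonneg c a) (G.adjacencyMatrix_nonneg c b)
  obtain ⟨μ, P, hiμ, hP0, hP, hev, hdom, hlim⟩ := hpsd.exists_tendsto_pow_mulVec_one hM0 hi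
  have hμ : 0 < μ := hi.trans_le hiμ
  have hs : 0 < ∑ w, |P w| := by
    obtain ⟨w, hw⟩ := Function.ne_iff.1 hP
    exact Finset.sum_pos' (fun _ _ => abs_nonneg _) ⟨w, Finset.mem_univ w, abs_pos.2 hw⟩
  -- The scaling by `μ ^ n` cancels in the normalized vector.
  have hconv : ∀ v, Tendsto (fun n => hitsNormalized G n v) atTop
      (𝓝 (P v / ∑ w, |P w|)) := fun v => by
    refine ((hlim v).div (tendsto_finsetSum _ fun w _ => (hlim w).abs) hs.ne').congr fun n => ?_
    have hn := pow_pos hμ n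
    simp only [Pi.div_apply, hitsNormalized, hitsAuthority_eq_pow_mulVec, ← hM, abs_div,
      ← Finset.sum_div, abs_of_pos hn]
    exact div_div_div_cancel_right₀ hn.ne' _ _
  have hscore : hitsScore G = (∑ w, |P w|)⁻¹ • P := funext fun v => by
    rw [hitsScore, (hconv v).limUnder_eq, Pi.smul_apply, smul_eq_mul, div_eq_inv_mul]
  have hne : hitsScore G ≠ 0 := by
    rw [hscore]
    exact smul_ne_zero (inv_ne_zero hs.ne') hP
  have heig : M *ᵥ hitsScore G = μ • hitsScore G := by
    rw [hscore, Matrix.mulVec_smul, hev, smul_comm]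
  refine ⟨?_, ⟨hne, μ, ?_, hdom⟩, fun v => ?_, μ, hiμ, ?_⟩
  · rw [tendsto_pi_nhds]
    intro v
    rw [hitsScore, (hconv v).limUnder_eq]
    exact hconv v
  · rw [← Matrix.mulVec_transpose, hM, Matrix.transpose_mul, Matrix.transpose_transpose, ← hM,
      heig]
  · rw [hscore]
    exact mul_nonneg (inv_nonneg.2 hs.le) (hP0 v)
  · rw [Matrix.mulVec_mulVec, ← hM, heig]

/-! ### The top eigenvector on a clique joined to a cycle -/

section CliqueCycle

variable {k p : ℕ} (x : Fin k) (y : Fin p)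

theorem cliqueCycleBridge_adjacencyMatrix_inl_inl (i j : Fin k) :
    (cliqueCycleBridge k p x y).adjacencyMatrix (.inl i) (.inl j) = 1 - if i = j then 1 else 0 := by
  by_cases h : i = j <;> simp [Digraph.adjacencyMatrix, cliqueCycleBridge, h]

theorem cliqueCycleBridge_mulVec_inl (v : Fin k ⊕ Fin p → ℝ) (i : Fin k) :
    ((cliqueCycleBridge k p x y).adjacencyMatrix *ᵥ v) (.inl i) =
      ∑ j, v (.inl j) - v (.inl i) + if i = x then v (.inr y) else 0 := by
  simp only [Matrix.mulVec, dotProduct, Fintype.sum_sum_type,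
    cliqueCycleBridge_adjacencyMatrix_inl_inl, sub_mul, one_mul, ite_mul, zero_mul,
    Finset.sum_sub_distrib, Finset.sum_ite_eq, Finset.mem_univ, if_true]
  by_cases hi : i = x <;> simp [Digraph.adjacencyMatrix, cliqueCycleBridge, hi]

theorem cliqueCycleBridge_transpose_mulVec_inl (v : Fin k ⊕ Fin p → ℝ) (i : Fin k) :
    ((cliqueCycleBridge k p x y).adjacencyMatrixᵀ *ᵥ v) (.inl i) =
      ∑ j, v (.inl j) - v (.inl i) + if i = x then v (.inr y) else 0 := by
  simp only [Matrix.mulVec, dotProduct, Fintype.sum_sum_type, Matrix.transpose_apply,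
    cliqueCycleBridge_adjacencyMatrix_inl_inl, sub_mul, one_mul, ite_mul, zero_mul,
    Finset.sum_sub_distrib, Finset.sum_ite_eq', Finset.mem_univ, if_true]
  by_cases hi : i = x <;> simp [Digraph.adjacencyMatrix, cliqueCycleBridge, hi]

/-- The arcs of the cycle, in the arithmetic of `Fin p`. -/
theorem Fin.val_eq_succ_mod_iff [NeZero p] (i j : Fin p) :
    (j : ℕ) = ((i : ℕ) + 1) % p ↔ j = i + 1 := by
  rw [Fin.ext_iff, Fin.val_add, Fin.val_one', Nat.add_mod_mod]

theorem cliqueCycleBridge_mulVec_inr [NeZero p] (v : Fin k ⊕ Fin p → ℝ) (j : Fin p) :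
    ((cliqueCycleBridge k p x y).adjacencyMatrix *ᵥ v) (.inr j) =
      v (.inr (j + 1)) + if j = y then v (.inl x) else 0 := by
  simp only [Matrix.mulVec, dotProduct, Digraph.adjacencyMatrix, cliqueCycleBridge,
    Matrix.of_apply, Fintype.sum_sum_type, ite_mul, one_mul, zero_mul, Fin.val_eq_succ_mod_iff]
  by_cases hj : j = y <;> simp [hj, add_comm]

theorem cliqueCycleBridge_transpose_mulVec_inr [NeZero p] (v : Fin k ⊕ Fin p → ℝ) (j : Fin p) :
    ((cliqueCycleBridge k p x y).adjacencyMatrixᵀ *ᵥ v) (.inr j) =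
      v (.inr (j - 1)) + if j = y then v (.inl x) else 0 := by
  have h : ∀ i, j = i + 1 ↔ i = j - 1 := fun i => by rw [eq_sub_iff_add_eq, eq_comm]
  simp only [Matrix.mulVec, dotProduct, Digraph.adjacencyMatrix, cliqueCycleBridge,
    Matrix.transpose_apply, Matrix.of_apply, Fintype.sum_sum_type, ite_mul, one_mul, zero_mul,
    Fin.val_eq_succ_mod_iff, h]
  by_cases hj : j = y <;> simp [hj, add_comm]

/-- The diagonal entry of `AᵀA` at `x` is the in-degree `k` of `x`. -/
theorem cliqueCycleBridge_gram_diag :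
    ((cliqueCycleBridge k p x y).adjacencyMatrixᵀ *
      (cliqueCycleBridge k p x y).adjacencyMatrix) (.inl x) (.inl x) = k := by
  have h := cliqueCycleBridge_transpose_mulVec_inl x y
    (fun u => (cliqueCycleBridge k p x y).adjacencyMatrix u (.inl x)) x
  have hyx : (cliqueCycleBridge k p x y).adjacencyMatrix (.inr y) (.inl x) = 1 := by
    simp [Digraph.adjacencyMatrix, cliqueCycleBridge]
  refine h.trans ?_
  simp [cliqueCycleBridge_adjacencyMatrix_inl_inl, hyx]

/-- A nonnegative eigenvector `v` of `AᵀA` whose eigenvalue `μ` is at least the diagonal entry `k`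
puts more weight on `x` than on `y`. With `S` the weight of the clique without `x`, the eigenvector
equations read `(μ - k) v_x = (k - 2) S + v_{y+1}` and `(μ - 2) v_y = S`; they decide the
comparison as soon as `S > 0`, and `S = 0` would force `v = 0`. -/
theorem cliqueCycleBridge_eigenvector_lt (hk : 3 ≤ k) (hp : 3 ≤ p) {v : Fin k ⊕ Fin p → ℝ}
    {μ : ℝ} (hμ : k ≤ μ) (hv : ∀ a, 0 ≤ v a) (hne : v ≠ 0)
    (heig : (cliqueCycleBridge k p x y).adjacencyMatrixᵀ *ᵥ
      ((cliqueCycleBridge k p x y).adjacencyMatrix *ᵥ v) = μ • v) :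
    v (.inr y) < v (.inl x) := by
  have : NeZero p := ⟨by omega⟩
  have hk' : (3 : ℝ) ≤ k := by exact_mod_cast hk
  have hone : (1 : Fin p) ≠ 0 := fun h => by
    have := congrArg Fin.val h
    rw [Fin.val_one', Fin.val_zero, Nat.mod_eq_of_lt (by omega)] at this
    omega
  set T := ∑ j, v (.inl j) with hT
  -- The hub weight of the whole clique.
  have hsum : ∑ i, ((cliqueCycleBridge k p x y).adjacencyMatrix *ᵥ v) (.inl i) =
      (k - 1) * T + v (.inr y) := by
    simp only [cliqueCycleBridge_mulVec_inl, Finset.sum_add_distrib, Finset.sum_sub_distrib,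
      Finset.sum_const, Finset.card_univ, Fintype.card_fin, Finset.sum_ite_eq', Finset.mem_univ,
      if_true, nsmul_eq_mul, ← hT]
    ring
  have hx : μ * v (.inl x) = (k - 2) * (T - v (.inl x)) + k * v (.inl x) + v (.inr (y + 1)) := by
    have h := congrFun heig (.inl x)
    rw [cliqueCycleBridge_transpose_mulVec_inl, hsum, cliqueCycleBridge_mulVec_inl,
      cliqueCycleBridge_mulVec_inr, ← hT] at h
    simp only [if_true, Pi.smul_apply, smul_eq_mul] at h
    linarith
  have hy : μ * v (.inr y) = 2 * v (.inr y) + (T - v (.inl x)) := by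
    have h := congrFun heig (.inr y)
    rw [cliqueCycleBridge_transpose_mulVec_inr, cliqueCycleBridge_mulVec_inl,
      cliqueCycleBridge_mulVec_inr, ← hT, sub_add_cancel,
      if_neg (fun h => hone (sub_eq_self.1 h))] at h
    simp only [if_true, Pi.smul_apply, smul_eq_mul] at h
    linarith
  have hi : ∀ i, i ≠ x → μ * v (.inl i) = (k - 2) * T + v (.inr y) + v (.inl i) := fun i hix => by
    have h := congrFun heig (.inl i)
    rw [cliqueCycleBridge_transpose_mulVec_inl, hsum, cliqueCycleBridge_mulVec_inl, ← hT] at h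
    simp only [if_neg hix, Pi.smul_apply, smul_eq_mul] at h
    linarith
  have hj : ∀ j, j ≠ y → j ≠ y + 1 → μ * v (.inr j) = v (.inr j) := fun j hjy hjy1 => by
    have h := congrFun heig (.inr j)
    rw [cliqueCycleBridge_transpose_mulVec_inr, cliqueCycleBridge_mulVec_inr, sub_add_cancel,
      if_neg hjy, if_neg (fun h => hjy1 (sub_eq_iff_eq_add.1 h))] at h
    simpa using h.symm
  have hS : T - v (.inl x) = ∑ i ∈ Finset.univ.erase x, v (.inl i) := by
    rw [hT, ← Finset.add_sum_erase _ _ (Finset.mem_univ x), add_sub_cancel_left]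
  have hS0 : 0 ≤ T - v (.inl x) := hS ▸ Finset.sum_nonneg fun i _ => hv _
  have hSpos : 0 < T - v (.inl x) := by
    refine hS0.lt_of_ne' fun h0 => hne ?_
    have hc : ∀ i, i ≠ x → v (.inl i) = 0 := fun i hix =>
      (Finset.sum_eq_zero_iff_of_nonneg fun i _ => hv _).1 (hS ▸ h0) i
        (Finset.mem_erase.2 ⟨hix, Finset.mem_univ i⟩)
    have : Nontrivial (Fin k) := Fin.nontrivial_iff_two_le.2 (by omega)
    obtain ⟨i, hix⟩ := exists_ne x
    have h := hi i hix
    rw [hc i hix] at h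
    have hvy := hv (.inr y)
    have hvx := hv (.inl x)
    have hTx : T = v (.inl x) := sub_eq_zero.1 h0
    have hx0 : v (.inl x) = 0 := by
      rw [hTx] at h
      nlinarith
    have hy0 : v (.inr y) = 0 := by
      rw [hTx, hx0] at h
      linarith
    have hy1 : v (.inr (y + 1)) = 0 := by
      rw [hTx, hx0] at hx
      linarith
    ext (i | j)
    · by_cases hix : i = x
      · rw [hix]; exact hx0
      · exact hc i hix
    · by_cases hjy : j = y
      · rw [hjy]; exact hy0
      by_cases hjy1 : j = y + 1
      · rw [hjy1]; exact hy1
      have := hj j hjy hjy1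
      show v (.inr j) = 0
      have : (μ - 1) * v (.inr j) = 0 := by linarith
      exact (mul_eq_zero.1 this).resolve_left (by linarith)
  -- If `v_x ≤ v_y`, then `S ≤ (k - 2) S ≤ (μ - k) v_x ≤ (μ - k) v_y < (μ - 2) v_y = S`.
  by_contra! hle
  have hy1 := hv (.inr (y + 1))
  have h1 : (μ - k) * v (.inl x) ≤ (μ - k) * v (.inr y) :=
    mul_le_mul_of_nonneg_left hle (by linarith)
  have h2 : T - v (.inl x) ≤ (k - 2) * (T - v (.inl x)) :=
    le_mul_of_one_le_left hS0 (by linarith)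
  have hypos : 0 < v (.inr y) := by
    refine (hv _).lt_of_ne' fun h0 => ?_
    rw [h0] at hy
    linarith
  have h3 : (μ - k) * v (.inr y) < (μ - 2) * v (.inr y) :=
    mul_lt_mul_of_pos_right (by linarith) hypos
  linarith

end CliqueCycle

theorem mainTheorem3 :
    HITS.SatisfiesDensityAxiom ∧
    ∀ (k p : ℕ) (x : Fin k) (y : Fin p), 3 ≤ k → 3 ≤ p →
      Tendsto (hitsNormalized (cliqueCycleBridge k p x y)) atTop
        (𝓝 (HITS.score (cliqueCycleBridge k p x y))) ∧
      IsLeftDominantEigenvector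
        ((cliqueCycleBridge k p x y).adjacencyMatrixᵀ * (cliqueCycleBridge k p x y).adjacencyMatrix)
        (HITS.score (cliqueCycleBridge k p x y)) ∧
      HITS.score (cliqueCycleBridge k p x y) (.inr y) <
        HITS.score (cliqueCycleBridge k p x y) (.inl x) := by
  have main : ∀ (k p : ℕ) (x : Fin k) (y : Fin p), 3 ≤ k → 3 ≤ p →
      Tendsto (hitsNormalized (cliqueCycleBridge k p x y)) atTop
        (𝓝 (HITS.score (cliqueCycleBridge k p x y))) ∧
      IsLeftDominantEigenvector
        ((cliqueCycleBridge k p x y).adjacencyMatrixᵀ * (cliqueCycleBridge k p x y).adjacencyMatrix)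
        (HITS.score (cliqueCycleBridge k p x y)) ∧
      HITS.score (cliqueCycleBridge k p x y) (.inr y) <
        HITS.score (cliqueCycleBridge k p x y) (.inl x) := by
    intro k p x y hk hp
    have hdiag := cliqueCycleBridge_gram_diag x y
    obtain ⟨hlim, hdom, h0, μ, hμ, heig⟩ :=
      exists_tendsto_hitsNormalized (cliqueCycleBridge k p x y) (i := .inl x)
        (by rw [hdiag]; exact_mod_cast (by omega : 0 < k))
    exact ⟨hlim, hdom,
      cliqueCycleBridge_eigenvector_lt x y hk hp (hdiag ▸ hμ) h0 hdom.1 heig⟩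
  exact ⟨fun k p x y hk hp _ => (main k p x y hk hp).2.2, main⟩
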